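/- Let $X$ be an infinite-dimensional complex Banach space and let $T$ be a bounded linear operator on $X$. Write $N(S)$ and $R(S)$ for the null space and the range of an operator $S$, $\sigma(T)$ for the spectrum of $T$, $\sigma_a(T)$ for its approximate point spectrum (the $\lambda\in\mathbb{C}$ such that $T-\lambda I$ is not bounded below), and $\operatorname{iso} A$ for the set of isolated points of $A\subseteq\mathbb{C}$. A bounded operator $S$ on a Banach space $Y$ is called Fredholm if $\dim N(S)<\infty$ and $\operatorname{codim} R(S)<\infty$ (so that $R(S)$ is closed), and its index is then $\dim N(S)-\operatorname{codim} R(S)$; it is called Weyl if it is Fredholm of index $0$. A bounded operator $S$ on $X$ is called B-Weyl if for some integer $n\ge 0$ the range $R(S^n)$ is closed and the restriction $S_{[n]}:R(S^n)\to R(S^n)$ of $S$ is Weyl. Let $\sigma_W(T)$, respectively $\sigma_{BW}(T)$, be the set of $\lambda\in\mathbb{C}$ such that $T-\lambda I$ is not Weyl, respectively not B-Weyl. The ascent and the descent of $S$ are $\inf\{n\ge 0: N(S^n)=N(S^{n+1})\}$ and $\inf\{n\ge 0: R(S^n)=R(S^{n+1})\}$, with $\inf\emptyset=\infty$. Put \[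 \begin{aligned} \Pi^0(T)&=\{\lambda\in\sigma(T): T-\lambda I \text{ has finite ascent and finite descent, and } \dim N(T-\lambda I)<\infty\},\\ E(T)&=\{\lambda\in\operatorname{iso}\sigma(T): N(T-\lambda I)\ne\{0\}\},\\ E^0(T)&=\{\lambda\in\operatorname{iso}\sigma(T): 0<\dim N(T-\lambda I)<\infty\},\\ E_a(T)&=\{\lambda\in\operatorname{iso}\sigma_a(T): N(T-\lambda I)\ne\{0\}\}. \end{aligned} \] ($\Pi^0(T)$ is the set of poles of finite rank of the resolvent of $T$.) The operator $T$ is said to satisfy property $(Z_{E_a})$ if $\sigma(T)\setminus\sigma_W(T)=E_a(T)$; Weyl's theorem if $\sigma(T)\setminus\sigma_W(T)=E^0(T)$; Browder's theorem if $\sigma(T)\setminus\sigma_W(T)=\Pi^0(T)$; and generalized Weyl's theorem if $\sigma(T)\setminus\sigma_{BW}(T)=E(T)$. Then the following statements are equivalent: (i) $T$ satisfies property $(Z_{E_a})$; (ii) $T$ satisfies Weyl's theorem and $E^0(T)=E_a(T)$; (iii) $T$ satisfies Browder's theorem and $\Pi^0(T)=E_a(T)$; (iv) $T$ satisfies generalized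 Weyl's theorem and $E^0(T)=E_a(T)$. -/

import Mathlib

open Filter Topology

namespace WeylType

variable {X : Type*} [NormedAddCommGroup X] [NormedSpace ℂ X]

/-- The isolated points `iso A` of a subset `A ⊆ ℂ`. -/
def iso (A : Set ℂ) : Set ℂ := {z | z ∈ A ∧ ¬ AccPt z (𝓟 A)}

/-- The operator `T - z I`. -/
def shift (T : X →L[ℂ] X) (z : ℂ) : X →L[ℂ] X := T - z • (1 : X →L[ℂ] X)

/-- `S` is bounded below: `c ‖x‖ ≤ ‖S x‖` for some `c > 0` and all `x`. -/
def IsBoundedBelow (S : X →L[ℂ] X) : Prop := ∃ c : ℝ, 0 < c ∧ ∀ x : X, c * ‖x‖ ≤ ‖S x‖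

/-- The approximate point spectrum `σ_a(T)`. -/
def approxSpectrum (T : X →L[ℂ] X) : Set ℂ := {z | ¬ IsBoundedBelow (shift T z)}

/-- The eigenvalues `σ_p(T)`. -/
def pointSpectrum (T : X →L[ℂ] X) : Set ℂ := {z | (shift T z).ker ≠ ⊥}

/-- The eigenvalues of finite multiplicity `σ_p⁰(T)`. -/
def finitePointSpectrum (T : X →L[ℂ] X) : Set ℂ :=
  {z | z ∈ pointSpectrum T ∧ FiniteDimensional ℂ (shift T z).ker}

/-- A Weyl operator: a Fredholm operator of index `0`. -/
def IsWeyl (S : X →L[ℂ] X) : Prop := S.IsFredholm ∧ S.toLinearMap.index = 0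

/-- The Weyl spectrum `σ_W(T)`. -/
def weylSpectrum (T : X →L[ℂ] X) : Set ℂ := {z | ¬ IsWeyl (shift T z)}

theorem mapsTo_range_pow (S : X →L[ℂ] X) (n : ℕ) :
    Set.MapsTo S ((S ^ n).range : Set X) ((S ^ n).range : Set X) := by
  rintro _ ⟨y, rfl⟩
  refine ⟨S y, ?_⟩
  change (S ^ n * S) y = (S * S ^ n) y
  rw [← pow_succ, ← pow_succ']

/-- The restriction `S_[n] : R(S ^ n) → R(S ^ n)` of `S`. -/
def restrictRangePow (S : X →L[ℂ] X) (n : ℕ) : (S ^ n).range →L[ℂ] (S ^ n).range :=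
  S.restrict (mapsTo_range_pow S n)

/-- A B-Weyl operator: for some `n ≥ 0` the range of `S ^ n` is closed and `S_[n]` is Weyl. -/
def IsBWeyl (S : X →L[ℂ] X) : Prop :=
  ∃ n : ℕ, IsClosed ((S ^ n).range : Set X) ∧ IsWeyl (restrictRangePow S n)

/-- The B-Weyl spectrum `σ_BW(T)`. -/
def bWeylSpectrum (T : X →L[ℂ] X) : Set ℂ := {z | ¬ IsBWeyl (shift T z)}

/-- The ascent `a(S)`, with `inf ∅ = ∞`. -/
noncomputable def ascent (S : X →L[ℂ] X) : ℕ∞ :=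
  ⨅ n ∈ {n : ℕ | (S ^ n).ker = (S ^ (n + 1)).ker}, (n : ℕ∞)

/-- The descent `δ(S)`, with `inf ∅ = ∞`. -/
noncomputable def descent (S : X →L[ℂ] X) : ℕ∞ :=
  ⨅ n ∈ {n : ℕ | (S ^ n).range = (S ^ (n + 1)).range}, (n : ℕ∞)

/-- The poles `Π(T)` of the resolvent of `T`. -/
def poles (T : X →L[ℂ] X) : Set ℂ :=
  {z | z ∈ spectrum ℂ T ∧ ascent (shift T z) < ⊤ ∧ descent (shift T z) < ⊤}

/-- The poles of finite rank `Π⁰(T)`: the poles `z` with `dim N(T - z I) < ∞`.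
As `N((T - z I) ^ p)` has dimension at most `p * dim N(T - z I)`, this says the same as that the
spectral projection at `z` has finite rank. -/
def finitePoles (T : X →L[ℂ] X) : Set ℂ :=
  {z | z ∈ poles T ∧ FiniteDimensional ℂ (shift T z).ker}

/-- `E(T)`: the eigenvalues that are isolated in the spectrum. -/
def E (T : X →L[ℂ] X) : Set ℂ := iso (spectrum ℂ T) ∩ pointSpectrum T

/-- `E⁰(T)`: the eigenvalues of finite multiplicity that are isolated in the spectrum. -/
def E0 (T : X →L[ℂ] X) : Set ℂ := iso (spectrum ℂ T) ∩ finitePointSpectrum T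

/-- `E_a(T)`: the eigenvalues that are isolated in the approximate point spectrum. -/
def Ea (T : X →L[ℂ] X) : Set ℂ := iso (approxSpectrum T) ∩ pointSpectrum T

/-- Weyl's theorem for `T`. -/
def WeylTheorem (T : X →L[ℂ] X) : Prop := spectrum ℂ T \ weylSpectrum T = E0 T

/-- Browder's theorem for `T`. -/
def BrowderTheorem (T : X →L[ℂ] X) : Prop := spectrum ℂ T \ weylSpectrum T = finitePoles T

/-- Generalized Weyl's theorem for `T`. -/
def GeneralizedWeylTheorem (T : X →L[ℂ] X) : Prop := spectrum ℂ T \ bWeylSpectrum T = E T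

/-- Property `(Z_{E_a})` for `T`. -/
def PropertyZEa (T : X →L[ℂ] X) : Prop := spectrum ℂ T \ weylSpectrum T = Ea T

end WeylType

/-! An injective Weyl operator is bijective, so every point of `σ(T) \ σ_W(T)` is an eigenvalue of
finite multiplicity. Weyl operators are stable under small scalar shifts; hence if `z ∈ E_a(T)` and
`T - z` is Weyl, then for `w ≠ z` near `z` the operator `T - w` is Weyl and injective, so bijective,
and `z ∈ E⁰(T)` (`mem_E0_of_mem_Ea`). Thus (i) forces `E⁰(T) = E_a(T)`, which gives (ii); the way
back is substitution.

For (iii), poles of finite rank always lie outside `σ_W(T)`. Conversely, if `z` is isolated in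
`σ(T)` and `T - z` is Weyl, injectivity of nearby `T - w` makes `T - z` injective on its hyperrange,
and index zero then yields finite ascent and descent (`mem_finitePoles_of_mem_iso`).

For (iv), B-Weyl and Weyl agree when the kernel is finite-dimensional
(`restrictRangePow_hasIndexZero_iff`). What remains is `σ(T) \ σ_BW(T) ⊆ E(T)`, which rests on the
punctured neighbourhood theorem `IsBWeyl.eventually_shift`. -/

section Algebra

open Module

variable {K : Type*} [Field K] {U V W : Type*} [AddCommGroup U] [Module K U]
  [AddCommGroup V] [Module K V] [AddCommGroup W] [Module K W]

/-! ### Algebraic index calculus. -/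

namespace LinearMap

/-- A linear map with finite-dimensional kernel and cokernel. -/
def HasFiniteIndex (f : V →ₗ[K] W) : Prop :=
  FiniteDimensional K f.ker ∧ FiniteDimensional K (W ⧸ f.range)

/-- A linear map with finite-dimensional kernel and cokernel of the same dimension. -/
def HasIndexZero (f : V →ₗ[K] W) : Prop := f.HasFiniteIndex ∧ f.index = 0

theorem HasFiniteIndex.comp {g : V →ₗ[K] W} {f : U →ₗ[K] V} (hg : g.HasFiniteIndex)
    (hf : f.HasFiniteIndex) : (g ∘ₗ f).HasFiniteIndex := by
  obtain ⟨_, _⟩ := hg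
  obtain ⟨_, _⟩ := hf
  constructor
  · rw [ker_comp]; infer_instance
  · rw [range_comp]; infer_instance

theorem HasFiniteIndex.index_comp {g : V →ₗ[K] W} {f : U →ₗ[K] V} (hg : g.HasFiniteIndex)
    (hf : f.HasFiniteIndex) : (g ∘ₗ f).index = g.index + f.index := by
  obtain ⟨_, _⟩ := hg
  obtain ⟨_, _⟩ := hf
  exact LinearMap.index_comp g

/-- Inside `f.range` the kernel of `g` is the image of `(g ∘ₗ f).ker`, and `f.range` has finite
codimension. -/
theorem HasFiniteIndex.of_comp_left {g : V →ₗ[K] W} {f : U →ₗ[K] V}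
    (h : (g ∘ₗ f).HasFiniteIndex) (hf : f.HasFiniteIndex) : g.HasFiniteIndex := by
  obtain ⟨h1, h2⟩ := h
  obtain ⟨_, _⟩ := hf
  refine ⟨?_, ?_⟩
  · rw [← Submodule.fg_iff_finiteDimensional] at h1 ⊢
    refine Submodule.fg_of_fg_map_of_fg_inf_ker f.range.mkQ ?_ ?_
    · exact IsNoetherian.noetherian _
    · have : g.ker ⊓ f.range.mkQ.ker = (g ∘ₗ f).ker.map f := by
        rw [Submodule.ker_mkQ, ker_comp, Submodule.map_comap_eq, inf_comm]
      rw [this]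
      exact h1.map f
  · exact Submodule.CoFG.of_le (range_comp_le_range f g) h2

/-- `g` induces a map from the cokernel of `f` to that of `g ∘ₗ f`, whose kernel is the image of
`g.ker`. -/
theorem HasFiniteIndex.of_comp_right {g : V →ₗ[K] W} {f : U →ₗ[K] V}
    (h : (g ∘ₗ f).HasFiniteIndex) (hg : g.HasFiniteIndex) : f.HasFiniteIndex := by
  obtain ⟨h1, h2⟩ := h
  obtain ⟨hg1, _⟩ := hg
  refine ⟨?_, ?_⟩
  · exact Submodule.finiteDimensional_of_le (ker_le_ker_comp f g)
  · have hle : f.range ≤ (g ∘ₗ f).range.comap g := by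
      rw [← Submodule.map_le_iff_le_comap, range_comp]
    have : (⊤ : Submodule K (V ⧸ f.range)).FG := by
      refine Submodule.fg_of_fg_map_of_fg_inf_ker (f.range.mapQ (g ∘ₗ f).range g hle)
        (IsNoetherian.noetherian _) ?_
      have hk : (⊤ : Submodule K (V ⧸ f.range)) ⊓ (f.range.mapQ (g ∘ₗ f).range g hle).ker =
          g.ker.map f.range.mkQ := by
        rw [top_inf_eq, Submodule.ker_mapQ, range_comp, Submodule.comap_map_eq,
          Submodule.map_sup, Submodule.mkQ_map_self, bot_sup_eq]
      rw [hk]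
      exact (Submodule.fg_iff_finiteDimensional _ |>.2 hg1).map _
    exact ⟨this⟩

theorem hasIndexZero_of_bijective {f : V →ₗ[K] W} (hf : Function.Bijective f) :
    f.HasIndexZero := by
  refine ⟨⟨?_, ?_⟩, LinearEquiv.index_eq_zero (e := LinearEquiv.ofBijective f hf)⟩
  · rw [ker_eq_bot.2 hf.1]; infer_instance
  · rw [range_eq_top.2 hf.2]; infer_instance

theorem HasIndexZero.surjective_of_ker_eq_bot {f : V →ₗ[K] W} (h : f.HasIndexZero)
    (hk : f.ker = ⊥) : Function.Surjective f := by
  obtain ⟨⟨_, _⟩, h2⟩ := h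
  rw [index_of_injective (ker_eq_bot.1 hk), neg_eq_zero, Nat.cast_eq_zero,
    finrank_zero_iff, Submodule.Quotient.subsingleton_iff] at h2
  exact range_eq_top.1 h2

theorem HasIndexZero.bijective_of_ker_eq_bot {f : V →ₗ[K] W} (h : f.HasIndexZero)
    (hk : f.ker = ⊥) : Function.Bijective f :=
  ⟨ker_eq_bot.1 hk, h.surjective_of_ker_eq_bot hk⟩

theorem hasFiniteIndex_subtype (p : Submodule K V) [FiniteDimensional K (V ⧸ p)] :
    p.subtype.HasFiniteIndex := by
  constructor
  · rw [Submodule.ker_subtype]; infer_instance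
  · rw [Submodule.range_subtype]; infer_instance

theorem hasFiniteIndex_of_surjective {f : V →ₗ[K] W} (hf : Function.Surjective f)
    (hk : FiniteDimensional K f.ker) : f.HasFiniteIndex := by
  refine ⟨hk, ?_⟩
  rw [range_eq_top.2 hf]; infer_instance

/-- Index zero is invariant under perturbations of finite rank. -/
theorem HasIndexZero.of_sub_hasFiniteRange {f g : V →ₗ[K] W} (hf : f.HasIndexZero)
    (h : FiniteDimensional K (f - g).range) : g.HasIndexZero := by
  have : FiniteDimensional K (V ⧸ (f - g).ker) :=
    (f - g).quotKerEquivRange.symm.finiteDimensional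
  have hs := hasFiniteIndex_subtype (f - g).ker
  -- The maps agree on `(f - g).ker`, a subspace of finite codimension, so additivity of the index
  -- compares them there.
  have e : g ∘ₗ (f - g).ker.subtype = f ∘ₗ (f - g).ker.subtype := by
    ext ⟨x, hx⟩
    exact (sub_eq_zero.1 hx).symm
  have h1 : (g ∘ₗ (f - g).ker.subtype).HasFiniteIndex := e ▸ hf.1.comp hs
  have h2 := h1.of_comp_left hs
  have := h2.index_comp hs
  rw [e, hf.1.index_comp hs, hf.2] at this
  exact ⟨h2, by lia⟩

/-- If `φ` intertwines `f` and `g` and has finite index, then `f` and `g` have index zero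
simultaneously. -/
theorem hasIndexZero_iff_of_comp_eq {φ : V →ₗ[K] W} (hφ : φ.HasFiniteIndex)
    {f : V →ₗ[K] V} {g : W →ₗ[K] W} (h : φ ∘ₗ f = g ∘ₗ φ) :
    f.HasIndexZero ↔ g.HasIndexZero := by
  constructor
  · rintro ⟨hf, h0⟩
    have hg : g.HasFiniteIndex := HasFiniteIndex.of_comp_left (h ▸ hφ.comp hf) hφ
    refine ⟨hg, ?_⟩
    have h1 := hφ.index_comp hf
    have h2 := hg.index_comp hφ
    rw [h] at h1
    lia
  · rintro ⟨hg, h0⟩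
    have hf : f.HasFiniteIndex := HasFiniteIndex.of_comp_right (h ▸ hg.comp hφ) hφ
    refine ⟨hf, ?_⟩
    have h1 := hφ.index_comp hf
    have h2 := hg.index_comp hφ
    rw [h] at h1
    lia

theorem HasFiniteIndex.pow {f : V →ₗ[K] V} (hf : f.HasFiniteIndex) (n : ℕ) :
    (f ^ n).HasFiniteIndex := by
  induction n with
  | zero => exact (hasIndexZero_of_bijective Function.bijective_id).1
  | succ n ih => rw [pow_succ]; exact ih.comp hf

theorem HasIndexZero.pow {f : V →ₗ[K] V} (hf : f.HasIndexZero) (n : ℕ) :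
    (f ^ n).HasIndexZero := by
  refine ⟨hf.1.pow n, ?_⟩
  induction n with
  | zero => exact index_id
  | succ n ih =>
    rw [pow_succ, Module.End.mul_eq_comp, (hf.1.pow n).index_comp hf.1, ih, hf.2, add_zero]

/-! ### Kernels and ranges of powers, ascent and descent. -/

theorem finiteDimensional_ker_pow {f : V →ₗ[K] V} (hf : FiniteDimensional K f.ker) (n : ℕ) :
    FiniteDimensional K (f ^ n).ker := by
  induction n with
  | zero => rw [pow_zero, show (1 : V →ₗ[K] V).ker = ⊥ from ker_id]; infer_instance
  | succ n ih => rw [pow_succ, Module.End.mul_eq_comp, ker_comp]; infer_instance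

theorem ker_pow_le_ker_pow (f : V →ₗ[K] V) {m n : ℕ} (h : m ≤ n) :
    (f ^ m).ker ≤ (f ^ n).ker := by
  obtain ⟨k, rfl⟩ := Nat.exists_eq_add_of_le' h
  rw [pow_add]
  exact ker_le_ker_comp _ _

theorem range_pow_le_range_pow (f : V →ₗ[K] V) {m n : ℕ} (h : m ≤ n) :
    (f ^ n).range ≤ (f ^ m).range := by
  obtain ⟨k, rfl⟩ := Nat.exists_eq_add_of_le h
  rw [pow_add]
  exact range_comp_le_range _ _

theorem ker_pow_eq_of_ker_pow_succ_eq {f : V →ₗ[K] V} {m : ℕ}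
    (h : (f ^ m).ker = (f ^ (m + 1)).ker) {n : ℕ} (hn : m ≤ n) : (f ^ n).ker = (f ^ m).ker := by
  induction n, hn using Nat.le_induction with
  | base => rfl
  | succ n hn ih =>
    rw [h, pow_succ, pow_succ, Module.End.mul_eq_comp, Module.End.mul_eq_comp, ker_comp,
      ker_comp, ih]

theorem range_pow_eq_of_range_pow_succ_eq {f : V →ₗ[K] V} {m : ℕ}
    (h : (f ^ m).range = (f ^ (m + 1)).range) {n : ℕ} (hn : m ≤ n) :
    (f ^ n).range = (f ^ m).range := by
  induction n, hn using Nat.le_induction with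
  | base => rfl
  | succ n hn ih =>
    rw [h, pow_succ', pow_succ', Module.End.mul_eq_comp, Module.End.mul_eq_comp, range_comp,
      range_comp, ih]

/-- A linear map of finite ascent and descent with finite-dimensional kernel has index zero. -/
theorem hasIndexZero_of_ker_pow_eq_of_range_pow_eq {f : V →ₗ[K] V}
    (hf : FiniteDimensional K f.ker) {a d : ℕ} (ha : (f ^ a).ker = (f ^ (a + 1)).ker)
    (hd : (f ^ d).range = (f ^ (d + 1)).range) : f.HasIndexZero := by
  have hk : ∀ n, a + d ≤ n → (f ^ n).ker = (f ^ (a + d)).ker := fun n hn ↦ by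
    rw [ker_pow_eq_of_ker_pow_succ_eq ha (by lia : a ≤ n),
      ker_pow_eq_of_ker_pow_succ_eq ha (by lia : a ≤ a + d)]
  have hr : ∀ n, a + d ≤ n → (f ^ n).range = (f ^ (a + d)).range := fun n hn ↦ by
    rw [range_pow_eq_of_range_pow_succ_eq hd (by lia : d ≤ n),
      range_pow_eq_of_range_pow_succ_eq hd (by lia : d ≤ a + d)]
  generalize a + d = p at hk hr
  have hp : FiniteDimensional K (f ^ p).ker := finiteDimensional_ker_pow hf p
  have hcod : (f ^ p).range ⊔ (f ^ p).ker = ⊤ := by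
    rw [eq_top_iff]
    intro x _
    -- Writing `f ^ p x = f ^ (2p) y` splits `x` as `f ^ p y` plus an element of the kernel of `f ^
    -- p`.
    have : (f ^ p) x ∈ (f ^ (p + p)).range := by
      rw [hr _ (by lia)]; exact ⟨x, rfl⟩
    obtain ⟨y, hy⟩ := this
    rw [Submodule.mem_sup]
    refine ⟨(f ^ p) y, ⟨y, rfl⟩, x - (f ^ p) y, ?_, by abel⟩
    rw [mem_ker, map_sub, ← hy, pow_add, Module.End.mul_apply, sub_self]
  have hpf : (f ^ p).HasFiniteIndex :=
    ⟨hp, Submodule.FG.cofg_of_codisjoint (codisjoint_iff.2 ((sup_comm _ _).trans hcod))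
      (Submodule.fg_iff_finiteDimensional _ |>.2 hp)⟩
  have hp1 : (f ^ (p + 1)).HasFiniteIndex := by
    unfold HasFiniteIndex
    rw [hk _ p.le_succ, hr _ p.le_succ]
    exact hpf
  have hfi : f.HasFiniteIndex := by
    rw [pow_succ, Module.End.mul_eq_comp] at hp1
    exact hp1.of_comp_right hpf
  refine ⟨hfi, ?_⟩
  -- Both powers have the same kernel and range, so additivity leaves index zero for `f`.
  have h1 : (f ^ (p + 1)).index = (f ^ p).index := by
    unfold index
    rw [hk _ p.le_succ, hr _ p.le_succ]
  rw [pow_succ, Module.End.mul_eq_comp, hpf.index_comp hfi] at h1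
  lia

/-! ### The hyperrange of a map with finite-dimensional kernel. -/

/-- The hyperrange `⋂ n, R(f ^ n)`. -/
def hyperrange (f : V →ₗ[K] V) : Submodule K V := ⨅ n : ℕ, (f ^ n).range

theorem mem_hyperrange {f : V →ₗ[K] V} {x : V} : x ∈ f.hyperrange ↔ ∀ n, x ∈ (f ^ n).range := by
  simp [hyperrange, Submodule.mem_iInf]

theorem apply_mem_hyperrange {f : V →ₗ[K] V} {x : V} (hx : x ∈ f.hyperrange) :
    f x ∈ f.hyperrange := by
  rw [mem_hyperrange] at hx ⊢
  intro n
  obtain ⟨y, rfl⟩ := hx n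
  refine ⟨f y, ?_⟩
  rw [← Module.End.mul_apply, ← Module.End.mul_apply, ← pow_succ, ← pow_succ']

/-- The subspaces `f.ker ⊓ (f ^ n).range` decrease inside a finite-dimensional space, hence
stabilize. -/
theorem exists_ker_inf_range_pow_le {f : V →ₗ[K] V} (hf : FiniteDimensional K f.ker) :
    ∃ m : ℕ, f.ker ⊓ (f ^ m).range ≤ f.hyperrange := by
  let F : ℕ →o (Submodule K f.ker)ᵒᵈ :=
    ⟨fun n ↦ OrderDual.toDual ((f ^ n).range.comap f.ker.subtype), fun m n h ↦
      OrderDual.toDual_le_toDual.2 (Submodule.comap_mono (range_pow_le_range_pow f h))⟩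
  obtain ⟨m, hm⟩ := IsArtinian.monotone_stabilizes F
  refine ⟨m, fun x hx ↦ mem_hyperrange.2 fun n ↦ ?_⟩
  rcases le_total n m with h | h
  · exact range_pow_le_range_pow f h hx.2
  · have : (f ^ m).range.comap f.ker.subtype = (f ^ n).range.comap f.ker.subtype := hm n h
    have h2 : (⟨x, hx.1⟩ : f.ker) ∈ (f ^ m).range.comap f.ker.subtype := hx.2
    rw [this] at h2
    exact h2

/-- A preimage in `(f ^ m).range`, with `m` past stabilization, differs from one in a deeper range
by an element of `f.ker ⊓ (f ^ m).range`, which already lies in the hyperrange. -/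
theorem exists_apply_eq_of_mem_hyperrange {f : V →ₗ[K] V} (hf : FiniteDimensional K f.ker)
    {x : V} (hx : x ∈ f.hyperrange) : ∃ y ∈ f.hyperrange, f y = x := by
  obtain ⟨m, hm⟩ := exists_ker_inf_range_pow_le hf
  have key : ∀ n, ∃ y ∈ (f ^ n).range, f y = x := fun n ↦ by
    obtain ⟨z, hz⟩ := mem_hyperrange.1 hx (n + 1)
    refine ⟨(f ^ n) z, ⟨z, rfl⟩, ?_⟩
    rw [← hz, pow_succ', Module.End.mul_apply]
  obtain ⟨y, hy, hyx⟩ := key m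
  refine ⟨y, mem_hyperrange.2 fun n ↦ ?_, hyx⟩
  rcases le_total n m with h | h
  · exact range_pow_le_range_pow f h hy
  · obtain ⟨y', hy', hyx'⟩ := key n
    have : y - y' ∈ f.hyperrange := hm
      ⟨mem_ker.2 (by rw [map_sub, hyx, hyx', sub_self]), sub_mem hy (range_pow_le_range_pow f h hy')⟩
    simpa using add_mem (mem_hyperrange.1 this n) hy'

/-- If `f` has index zero and is injective on its hyperrange, then it has finite ascent and
descent. -/
theorem HasIndexZero.exists_ker_pow_eq_and_range_pow_eq {f : V →ₗ[K] V} (hf : f.HasIndexZero)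
    (h : f.ker ⊓ f.hyperrange = ⊥) :
    ∃ m : ℕ, (f ^ m).ker = (f ^ (m + 1)).ker ∧ (f ^ m).range = (f ^ (m + 1)).range := by
  obtain ⟨m, hm⟩ := exists_ker_inf_range_pow_le hf.1.1
  have hk : (f ^ m).ker = (f ^ (m + 1)).ker := by
    refine le_antisymm (ker_pow_le_ker_pow f m.le_succ) fun x hx ↦ ?_
    have h1 : (f ^ m) x ∈ f.ker ⊓ (f ^ m).range := by
      refine ⟨mem_ker.2 ?_, ⟨x, rfl⟩⟩
      rwa [← Module.End.mul_apply, ← pow_succ']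
    have h2 : (f ^ m) x ∈ f.ker ⊓ f.hyperrange := ⟨h1.1, hm h1⟩
    rwa [h, Submodule.mem_bot] at h2
  refine ⟨m, hk, ?_⟩
  have hle := range_pow_le_range_pow f m.le_succ
  have i1 := (hf.pow m).2
  have i2 := (hf.pow (m + 1)).2
  have := (hf.pow m).1.2
  have := (hf.pow (m + 1)).1.2
  unfold index at i1 i2
  rw [← hk] at i2
  -- Two powers of index zero with equal kernels have cokernels of equal dimension, so the canonical
  -- surjection between these is injective.
  have hfr : finrank K (V ⧸ (f ^ (m + 1)).range) = finrank K (V ⧸ (f ^ m).range) := by lia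
  have hinj : Function.Injective (Submodule.factor hle) :=
    (injective_iff_surjective_of_finrank_eq_finrank hfr).2 (Submodule.factor_surjective hle)
  refine le_antisymm (fun x hx ↦ ?_) hle
  rw [← Submodule.Quotient.mk_eq_zero] at hx ⊢
  apply hinj
  rw [map_zero]
  exact hx

/-! ### Comparing `f - c` with its restriction to `R(f ^ n)`, for `c ≠ 0`. -/

section Restrict

variable {f : V →ₗ[K] V} {n : ℕ} {c : K}

/-- Since `f ^ n - c ^ n = q (f - c)` with `q` commuting with `f ^ n`, the vector `c ^ n • x` lies
in `R(f ^ n)`. -/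
theorem mem_range_pow_of_sub_smul_apply_mem (hc : c ≠ 0) {x : V}
    (hx : (f - c • 1) x ∈ (f ^ n).range) : x ∈ (f ^ n).range := by
  have h1 : (∑ i ∈ Finset.range n, f ^ i * (c • 1) ^ (n - 1 - i)) * (f - c • 1) =
      f ^ n - (c • (1 : V →ₗ[K] V)) ^ n :=
    ((Commute.one_right f).smul_right c).geom_sum₂_mul n
  set q := ∑ i ∈ Finset.range n, f ^ i * (c • (1 : V →ₗ[K] V)) ^ (n - 1 - i)
  have hq : Commute q (f ^ n) := by
    refine Commute.sum_left _ _ _ fun i _ ↦ Commute.mul_left ?_ ?_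
    · exact Commute.pow_pow_self f i n
    · exact (((Commute.one_left _).smul_left c).pow_left _)
  obtain ⟨z, hz⟩ := hx
  have h2 : c ^ n • x = (f ^ n) (x - q z) := by
    have h3 := congr($h1 x)
    rw [Module.End.mul_apply, ← hz, ← Module.End.mul_apply, hq.eq, smul_pow, one_pow] at h3
    rw [map_sub, ← Module.End.mul_apply, h3]
    simp
  rw [← inv_smul_smul₀ (pow_ne_zero n hc) x, h2]
  exact Submodule.smul_mem _ _ ⟨_, rfl⟩

/-- By the same factorization, `f - c` is surjective modulo `R(f ^ n)`. -/
theorem exists_sub_mem_range_pow (hc : c ≠ 0) (x : V) :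
    ∃ y : V, x - (f - c • 1) y ∈ (f ^ n).range := by
  have h1 : (f - c • 1) * (∑ i ∈ Finset.range n, f ^ i * (c • 1) ^ (n - 1 - i)) =
      f ^ n - (c • (1 : V →ₗ[K] V)) ^ n :=
    ((Commute.one_right f).smul_right c).mul_geom_sum₂ n
  set q := ∑ i ∈ Finset.range n, f ^ i * (c • (1 : V →ₗ[K] V)) ^ (n - 1 - i)
  refine ⟨-((c ^ n)⁻¹ • q x), (c ^ n)⁻¹ • x, ?_⟩
  have h3 := congr($h1 x)
  rw [Module.End.mul_apply] at h3
  rw [map_neg, map_smul, map_smul, h3, smul_pow, one_pow]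
  simp [smul_sub, inv_smul_smul₀ (pow_ne_zero n hc)]

variable {p : Submodule K V} {g : p →ₗ[K] p}

theorem ker_eq_bot_iff_of_range_pow (hp : p = (f ^ n).range) (hc : c ≠ 0)
    (hg : ∀ x, (g x : V) = (f - c • 1) x) :
    (f - c • 1).ker = ⊥ ↔ g.ker = ⊥ := by
  subst hp
  simp only [ker_eq_bot']
  constructor
  · intro h x hx
    have := hg x
    rw [hx] at this
    exact Subtype.ext (h x this.symm)
  · intro h x hx
    have hm : x ∈ (f ^ n).range :=
      mem_range_pow_of_sub_smul_apply_mem hc (by rw [hx]; exact zero_mem _)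
    exact congr(($(h ⟨x, hm⟩ (Subtype.ext (by rw [hg, hx]; rfl))) : V))

/-- For `c ≠ 0`, the map `f - c` has index zero if its restriction to `R(f ^ n)` does. -/
theorem HasIndexZero.of_range_pow (hp : p = (f ^ n).range) (hc : c ≠ 0)
    (hg : ∀ x, (g x : V) = (f - c • 1) x)
    (h : g.HasIndexZero) : (f - c • 1).HasIndexZero := by
  subst hp
  let e : g.ker ≃ₗ[K] (f - c • 1).ker := by
    refine LinearEquiv.ofBijective
      ((f ^ n).range.subtype.restrict (p := g.ker) (q := (f - c • 1).ker) ?_) ⟨?_, ?_⟩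
    · intro x hx
      rw [mem_ker] at hx ⊢
      change (f - c • 1) x = 0
      rw [← hg, hx]; rfl
    · intro x y hxy
      exact Subtype.ext (Subtype.ext congr(($hxy : V)))
    · rintro ⟨x, hx⟩
      have hm : x ∈ (f ^ n).range :=
        mem_range_pow_of_sub_smul_apply_mem hc (by rw [mem_ker.1 hx]; exact zero_mem _)
      refine ⟨⟨⟨x, hm⟩, mem_ker.2 (Subtype.ext ?_)⟩, rfl⟩
      rw [hg]
      exact hx
  have hle : g.range ≤ (f - c • 1).range.comap (f ^ n).range.subtype := by
    rintro _ ⟨y, rfl⟩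
    exact ⟨y, (hg y).symm⟩
  let e' : ((f ^ n).range ⧸ g.range) ≃ₗ[K] V ⧸ (f - c • 1).range := by
    refine LinearEquiv.ofBijective (g.range.mapQ (f - c • 1).range (f ^ n).range.subtype hle) ⟨?_, ?_⟩
    · rw [← ker_eq_bot, Submodule.ker_mapQ, eq_bot_iff, Submodule.map_le_iff_le_comap,
        Submodule.comap_bot, Submodule.ker_mkQ]
      rintro ⟨x, hx⟩ ⟨y, hy⟩
      have hm : y ∈ (f ^ n).range := mem_range_pow_of_sub_smul_apply_mem hc (by rw [hy]; exact hx)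
      exact ⟨⟨y, hm⟩, Subtype.ext ((hg _).trans hy)⟩
    · intro x
      obtain ⟨x, rfl⟩ := Submodule.mkQ_surjective _ x
      obtain ⟨y, hy⟩ := exists_sub_mem_range_pow (f := f) (n := n) hc x
      refine ⟨g.range.mkQ ⟨_, hy⟩, ?_⟩
      rw [Submodule.mkQ_apply, Submodule.mapQ_apply]
      refine (Submodule.Quotient.eq _).2 ⟨-y, ?_⟩
      rw [map_neg]
      exact (sub_sub_cancel_left x _).symm
  obtain ⟨⟨_, _⟩, h0⟩ := h
  refine ⟨⟨e.finiteDimensional, e'.finiteDimensional⟩, ?_⟩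
  rw [index, ← e.finrank_eq, ← e'.finrank_eq]
  exact h0

end Restrict

end LinearMap

end Algebra

/-! ### Fredholm operators on Banach spaces and their small perturbations. -/

section Banach

open LinearMap

namespace ContinuousLinearMap

variable {X Y : Type*} [NormedAddCommGroup X] [NormedSpace ℂ X] [CompleteSpace X]
  [NormedAddCommGroup Y] [NormedSpace ℂ Y] [CompleteSpace Y]

/-- Between Banach spaces, a bounded operator with finite-dimensional kernel and cokernel is
Fredholm. -/
theorem isFredholm_of_hasFiniteIndex {S : X →L[ℂ] Y} (h : S.toLinearMap.HasFiniteIndex) :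
    S.IsFredholm := by
  obtain ⟨hk, hc⟩ := h
  obtain ⟨Z, hZ, hSZ⟩ :=
    (Submodule.ClosedComplemented.of_finiteDimensional S.ker).exists_isClosed_isCompl
  have : CompleteSpace Z := hZ.completeSpace_coe
  let s : Z →L[ℂ] Y := S ∘L Z.subtypeL
  have hsk : s.ker = ⊥ := by
    rw [LinearMap.ker_eq_bot']
    intro z hz
    exact Subtype.ext ((Submodule.disjoint_def.1 hSZ.disjoint) z hz z.2)
  have hsr : s.range = S.range := by
    refine le_antisymm (LinearMap.range_comp_le_range _ _) ?_
    rintro _ ⟨x, rfl⟩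
    obtain ⟨k, hk, z, hz, rfl⟩ := Submodule.mem_sup.1
      (hSZ.sup_eq_top ▸ Submodule.mem_top : x ∈ S.ker ⊔ Z)
    refine ⟨⟨z, hz⟩, ?_⟩
    have hk0 : S k = 0 := hk
    simp [s, hk0]
  obtain ⟨G, hG⟩ := Submodule.exists_isCompl s.range
  have hc' : s.range.CoFG := hsr ▸ hc
  have hGf : FiniteDimensional ℂ G := .of_fg (hc'.fg_of_isCompl hG)
  -- An injective bounded operator whose range has a closed algebraic complement has closed range.
  have hcl : IsClosed (s.range : Set Y) :=
    closed_complemented_range_of_isCompl_of_ker_eq_bot s G hG G.closed_of_finiteDimensional hsk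
  have hinj : Function.Injective s := LinearMap.ker_eq_bot.1 hsk
  have hZc : Z.CoFG := Submodule.FG.cofg_of_isCompl hSZ
    (Submodule.fg_iff_finiteDimensional _ |>.2 hk)
  refine IsFredholm.of_isInvertible_restrict (E₁ := Z) (F₁ := s.range) hZ hcl
    (fun z hz ↦ ⟨⟨z, hz⟩, rfl⟩) ⟨s.equivRange hinj (by rwa [LinearMap.coe_range] at hcl), ?_⟩
  ext z
  rfl

theorem exists_rightInverse_of_finiteDimensional_ker {S : X →L[ℂ] Y}
    (hS : Function.Surjective S) (hk : FiniteDimensional ℂ S.ker) :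
    ∃ B : Y →L[ℂ] X, ∀ y, S (B y) = y := by
  obtain ⟨Z, hZ, hSZ⟩ :=
    (Submodule.ClosedComplemented.of_finiteDimensional S.ker).exists_isClosed_isCompl
  have : CompleteSpace Z := hZ.completeSpace_coe
  let s : Z →L[ℂ] Y := S ∘L Z.subtypeL
  have hsk : s.ker = ⊥ := by
    rw [LinearMap.ker_eq_bot']
    intro z hz
    exact Subtype.ext ((Submodule.disjoint_def.1 hSZ.disjoint) z hz z.2)
  have hsr : s.range = ⊤ := by
    rw [eq_top_iff]
    intro y _
    obtain ⟨x, rfl⟩ := hS y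
    obtain ⟨k, hk, z, hz, rfl⟩ := Submodule.mem_sup.1
      (hSZ.sup_eq_top ▸ Submodule.mem_top : x ∈ S.ker ⊔ Z)
    refine ⟨⟨z, hz⟩, ?_⟩
    have hk0 : S k = 0 := hk
    simp [s, hk0]
  let e := ContinuousLinearEquiv.ofBijective s hsk hsr
  exact ⟨Z.subtypeL ∘L e.symm, fun y ↦ ContinuousLinearEquiv.ofBijective_apply_symm_apply s hsk hsr y⟩

/-- An operator of index zero is a finite rank perturbation of an invertible operator. -/
theorem exists_isUnit_finiteDimensional_range_sub {S : X →L[ℂ] X}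
    (h : S.toLinearMap.HasIndexZero) :
    ∃ U : X →L[ℂ] X, IsUnit U ∧ FiniteDimensional ℂ (U - S).range := by
  obtain ⟨⟨hk, hc⟩, h0⟩ := h
  obtain ⟨P, hP⟩ := Submodule.ClosedComplemented.of_finiteDimensional S.ker
  obtain ⟨G, hG⟩ := Submodule.exists_isCompl S.range
  have hGf : FiniteDimensional ℂ G :=
    (Submodule.quotientEquivOfIsCompl _ _ hG).finiteDimensional
  have hfr : Module.finrank ℂ S.ker = Module.finrank ℂ G := by
    rw [← (Submodule.quotientEquivOfIsCompl _ _ hG).finrank_eq]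
    unfold LinearMap.index at h0
    lia
  let e : S.ker ≃L[ℂ] G := ContinuousLinearEquiv.ofFinrankEq hfr
  -- Index zero allows an isomorphism from the kernel onto a complement of the range; adding it to
  -- `S` repairs both defects at once.
  let F : X →L[ℂ] X := G.subtypeL ∘L e.toContinuousLinearMap ∘L P
  have hF : ∀ x, F x = e (P x) := fun x ↦ rfl
  refine ⟨S + F, ?_, ?_⟩
  · rw [isUnit_iff_bijective]
    constructor
    · rw [injective_iff_map_eq_zero]
      intro x hx
      have hx' : S x + e (P x) = 0 := hx
      have h1 : S x ∈ G := by
        rw [eq_neg_of_add_eq_zero_left hx']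
        exact neg_mem (e (P x)).2
      have h2 : S x = 0 := Submodule.disjoint_def.1 hG.disjoint _ ⟨x, rfl⟩ h1
      rw [h2, zero_add] at hx'
      have h3 : P x = 0 := e.map_eq_zero_iff.1 (Subtype.ext hx')
      have h4 := hP ⟨x, h2⟩
      rw [show P ((⟨x, h2⟩ : S.ker) : X) = 0 from h3] at h4
      exact congr(($h4.symm : X))
    · intro y
      obtain ⟨_, ⟨x, rfl⟩, g, hg, rfl⟩ := Submodule.mem_sup.1
        (hG.sup_eq_top ▸ Submodule.mem_top : y ∈ S.range ⊔ G)
      refine ⟨x - P x + e.symm ⟨g, hg⟩, ?_⟩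
      have h1 : S (P x) = 0 := (P x).2
      have h2 : S (e.symm ⟨g, hg⟩) = 0 := (e.symm ⟨g, hg⟩).2
      rw [_root_.add_apply, hF]
      simp [h1, h2, hP]
  · rw [add_sub_cancel_left]
    have hle : F.range ≤ G := by
      rintro _ ⟨x, rfl⟩
      exact (e (P x)).2
    exact Submodule.finiteDimensional_of_le hle

theorem eventually_isUnit_sub_smul {U : X →L[ℂ] X} (hU : IsUnit U) (B : X →L[ℂ] X) :
    ∀ᶠ c : ℂ in 𝓝 0, IsUnit (U - c • B) := by
  have hc : Continuous fun c : ℂ ↦ U - c • B := by fun_prop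
  have h0 : Tendsto (fun c : ℂ ↦ U - c • B) (𝓝 0) (𝓝 U) := by
    simpa using hc.tendsto 0
  exact h0.eventually (Units.isOpen.mem_nhds hU)

/-- The operators of index zero are stable under small perturbations by scalars. -/
theorem eventually_hasIndexZero_sub_smul {S : X →L[ℂ] X} (h : S.toLinearMap.HasIndexZero) :
    ∀ᶠ c : ℂ in 𝓝 0, (S - c • (1 : X →L[ℂ] X)).toLinearMap.HasIndexZero := by
  obtain ⟨U, hU, hF⟩ := exists_isUnit_finiteDimensional_range_sub h
  filter_upwards [eventually_isUnit_sub_smul hU 1] with c hc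
  refine (hasIndexZero_of_bijective
    (isUnit_iff_bijective.1 hc)).of_sub_hasFiniteRange ?_
  rw [← toLinearMap_sub, sub_sub_sub_cancel_right]
  exact hF

/-- For a Fredholm operator `S` and all small `c ≠ 0`, the operator `S - c` is injective if and
only if `S` is injective on its hyperrange. -/
theorem eventually_ker_sub_smul_eq_bot_iff {S : X →L[ℂ] X}
    (h : S.toLinearMap.HasFiniteIndex) :
    ∀ᶠ c : ℂ in 𝓝[≠] 0, (S - c • (1 : X →L[ℂ] X)).ker = ⊥ ↔
      S.ker ⊓ S.toLinearMap.hyperrange = ⊥ := by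
  set M := S.toLinearMap.hyperrange
  have hM : IsClosed (M : Set X) := by
    have : (M : Set X) = ⋂ n : ℕ, ((S.toLinearMap ^ n).range : Set X) := by
      simp [M, LinearMap.hyperrange]
    rw [this]
    refine isClosed_iInter fun n ↦ ?_
    rw [← toLinearMap_pow]
    refine (isFredholm_of_hasFiniteIndex ?_).isClosed_range
    rw [toLinearMap_pow]
    exact h.pow n
  have : CompleteSpace M := hM.completeSpace_coe
  let s : M →L[ℂ] M := S.restrict fun x hx ↦ apply_mem_hyperrange hx
  have hs : ∀ x : M, (s x : X) = S x := fun x ↦ rfl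
  have hsurj : Function.Surjective s := by
    rintro ⟨x, hx⟩
    obtain ⟨y, hy, hyx⟩ := exists_apply_eq_of_mem_hyperrange h.1 hx
    exact ⟨⟨y, hy⟩, Subtype.ext hyx⟩
  have hker : FiniteDimensional ℂ s.ker := by
    have := h.1
    refine FiniteDimensional.of_injective
      (M.subtype.restrict (p := s.ker) (q := S.ker) fun x hx ↦ ?_) ?_
    · exact congr(($(LinearMap.mem_ker.1 hx) : X))
    · intro x y hxy
      exact Subtype.ext (Subtype.ext congr(($hxy : X)))
  obtain ⟨B, hB⟩ := exists_rightInverse_of_finiteDimensional_ker hsurj hker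
  filter_upwards [nhdsWithin_le_nhds (eventually_isUnit_sub_smul isUnit_one B), self_mem_nhdsWithin] with c hc hc0
  have hbij := isUnit_iff_bijective.1 hc
  -- On the hyperrange `s - c = s (1 - c B)` with `B` a right inverse of `s`. For small `c` the
  -- second factor is invertible, so `s - c` and `s` are injective together.
  have key : ∀ u : M, (s (((1 : M →L[ℂ] M) - c • B) u) : X) = (S - c • (1 : X →L[ℂ] X)) u := by
    intro u
    simp [hB, hs]
  constructor
  · intro hk
    rw [eq_bot_iff]
    rintro x ⟨hx, hxM⟩
    obtain ⟨u, hu⟩ := hbij.2 ⟨x, hxM⟩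
    have h1 := key u
    rw [hu, hs] at h1
    have h2 : (u : X) = 0 := LinearMap.ker_eq_bot'.1 hk u (h1.symm.trans hx)
    have h3 : u = 0 := Subtype.ext h2
    rw [h3, map_zero] at hu
    exact congr(($hu.symm : X))
  · intro hk
    refine LinearMap.ker_eq_bot'.2 fun x hx ↦ ?_
    have hSx : S x = c • x := sub_eq_zero.1 hx
    have hpow : ∀ n : ℕ, (S.toLinearMap ^ n) x = c ^ n • x := fun n ↦ by
      induction n with
      | zero => simp
      | succ n ih =>
        rw [_root_.pow_succ', Module.End.mul_apply, ih, map_smul, coe_coe, hSx, smul_smul,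
          ← _root_.pow_succ]
    -- Eigenvectors for `c ≠ 0` lie in the hyperrange, so the kernel of `S - c` is seen there.
    have hxM : x ∈ M := mem_hyperrange.2 fun n ↦ by
      rw [← inv_smul_smul₀ (pow_ne_zero n hc0) x, ← hpow]
      exact Submodule.smul_mem _ _ ⟨x, rfl⟩
    have h1 := key ⟨x, hxM⟩
    set v := ((1 : M →L[ℂ] M) - c • B) ⟨x, hxM⟩ with hv
    have h2 : (v : X) ∈ S.ker ⊓ M := ⟨(hs v).symm.trans (h1.trans hx), v.2⟩
    rw [hk, Submodule.mem_bot] at h2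
    have h3 : (⟨x, hxM⟩ : M) = 0 := hbij.1 (by rw [← hv, map_zero]; exact Subtype.ext h2)
    exact congr(($h3 : X))

end ContinuousLinearMap

end Banach

/-! ### Spectra, poles and B-Weyl operators. -/

namespace WeylType

open LinearMap ContinuousLinearMap

variable {X : Type*} [NormedAddCommGroup X] [NormedSpace ℂ X]

theorem shift_shift (T : X →L[ℂ] X) (z w : ℂ) : shift (shift T z) (w - z) = shift T w := by
  simp only [shift, sub_smul]
  abel

theorem ascent_lt_top_iff {S : X →L[ℂ] X} :
    ascent S < ⊤ ↔ ∃ n : ℕ, (S ^ n).ker = (S ^ (n + 1)).ker := by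
  simp [ascent, iInf_lt_iff]

theorem descent_lt_top_iff {S : X →L[ℂ] X} :
    descent S < ⊤ ↔ ∃ n : ℕ, (S ^ n).range = (S ^ (n + 1)).range := by
  simp [descent, iInf_lt_iff]

theorem mem_iso_iff {A : Set ℂ} {z : ℂ} : z ∈ iso A ↔ z ∈ A ∧ ∀ᶠ w in 𝓝[≠] z, w ∉ A := by
  rw [iso, Set.mem_ofPred_eq, accPt_iff_frequently_nhdsNE, not_frequently]

theorem tendsto_sub_nhdsNE_zero (z : ℂ) : Tendsto (fun w ↦ w - z) (𝓝[≠] z) (𝓝[≠] 0) := by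
  refine tendsto_nhdsWithin_iff.2 ⟨?_, ?_⟩
  · have : Tendsto (fun w : ℂ ↦ w - z) (𝓝 z) (𝓝 (z - z)) := by
      exact (continuous_id.sub continuous_const).tendsto z
    rw [sub_self] at this
    exact this.mono_left nhdsWithin_le_nhds
  · filter_upwards [self_mem_nhdsWithin] with w hw
    exact sub_ne_zero.2 hw

theorem pointSpectrum_subset_approxSpectrum (T : X →L[ℂ] X) :
    pointSpectrum T ⊆ approxSpectrum T := by
  rintro z hz ⟨c, hc, h⟩
  refine hz (LinearMap.ker_eq_bot'.2 fun x hx ↦ ?_)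
  have h1 := h x
  rw [show shift T z x = 0 from hx, norm_zero] at h1
  exact norm_le_zero_iff.1 (nonpos_of_mul_nonpos_right h1 hc)

theorem ker_shift_eq_bot_of_notMem_approxSpectrum {T : X →L[ℂ] X} {z : ℂ}
    (hz : z ∉ approxSpectrum T) : (shift T z).ker = ⊥ :=
  not_not.1 fun h ↦ hz (pointSpectrum_subset_approxSpectrum T h)

theorem E0_subset_E (T : X →L[ℂ] X) : E0 T ⊆ E T := fun _ hz ↦ ⟨hz.1, hz.2.1⟩

/-- `S ^ n`, viewed as a surjection onto its range, has finite index and intertwines `S` with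
`S_[n]`. -/
theorem restrictRangePow_hasIndexZero_iff {S : X →L[ℂ] X} (n : ℕ)
    (hk : FiniteDimensional ℂ (S ^ n).ker) :
    S.toLinearMap.HasIndexZero ↔ (restrictRangePow S n).toLinearMap.HasIndexZero := by
  refine hasIndexZero_iff_of_comp_eq (φ := (S ^ n).toLinearMap.rangeRestrict)
    (hasFiniteIndex_of_surjective (LinearMap.surjective_rangeRestrict _) ?_) ?_
  · rwa [LinearMap.ker_rangeRestrict]
  · ext x
    change (S ^ n * S) x = (S * S ^ n) x
    rw [← pow_succ, ← pow_succ']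

variable [CompleteSpace X]

theorem mem_spectrum_iff {T : X →L[ℂ] X} {z : ℂ} :
    z ∈ spectrum ℂ T ↔ ¬ Function.Bijective (shift T z) := by
  rw [spectrum.mem_iff, ← isUnit_iff_bijective, ← IsUnit.neg_iff, neg_sub]
  rfl

theorem approxSpectrum_subset_spectrum (T : X →L[ℂ] X) : approxSpectrum T ⊆ spectrum ℂ T := by
  intro z hz
  refine mem_spectrum_iff.2 fun h ↦ hz ?_
  obtain ⟨K, hK⟩ := antilipschitz_of_injective_of_isClosed_range (shift T z) h.1
    (by rw [h.2.range_eq]; exact isClosed_univ)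
  refine ⟨(K + 1 : ℝ)⁻¹, by positivity, fun x ↦ ?_⟩
  have h1 := hK.le_mul_dist x 0
  rw [map_zero, dist_zero_right, dist_zero_right] at h1
  rw [inv_mul_le_iff₀ (by positivity)]
  nlinarith [norm_nonneg (shift T z x)]

theorem pointSpectrum_subset_spectrum (T : X →L[ℂ] X) : pointSpectrum T ⊆ spectrum ℂ T :=
  (pointSpectrum_subset_approxSpectrum T).trans (approxSpectrum_subset_spectrum T)

theorem E_subset_Ea (T : X →L[ℂ] X) : E T ⊆ Ea T := by
  rintro z ⟨hz, hp⟩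
  refine ⟨mem_iso_iff.2 ⟨pointSpectrum_subset_approxSpectrum T hp, ?_⟩, hp⟩
  filter_upwards [(mem_iso_iff.1 hz).2] with w hw h
  exact hw (approxSpectrum_subset_spectrum T h)

theorem isWeyl_iff_hasIndexZero {S : X →L[ℂ] X} : IsWeyl S ↔ S.toLinearMap.HasIndexZero := by
  constructor
  · rintro ⟨h, h0⟩
    exact ⟨⟨h.finite_ker, h.finite_coker⟩, h0⟩
  · rintro ⟨h, h0⟩
    exact ⟨isFredholm_of_hasFiniteIndex h, h0⟩

theorem IsWeyl.bijective_of_ker_eq_bot {S : X →L[ℂ] X} (h : IsWeyl S) (hk : S.ker = ⊥) :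
    Function.Bijective S :=
  (isWeyl_iff_hasIndexZero.1 h).bijective_of_ker_eq_bot hk

theorem mem_spectrum_diff_weylSpectrum_iff {T : X →L[ℂ] X} {z : ℂ} :
    z ∈ spectrum ℂ T \ weylSpectrum T ↔ z ∈ pointSpectrum T ∧ IsWeyl (shift T z) := by
  rw [Set.mem_sdiff, weylSpectrum, Set.mem_ofPred_eq, not_not]
  refine and_congr_left fun h ↦ ⟨fun hz hk ↦ ?_, fun hz ↦ pointSpectrum_subset_spectrum T hz⟩
  exact mem_spectrum_iff.1 hz (h.bijective_of_ker_eq_bot hk)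

theorem spectrum_diff_weylSpectrum_subset_finitePointSpectrum (T : X →L[ℂ] X) :
    spectrum ℂ T \ weylSpectrum T ⊆ finitePointSpectrum T := fun _ hz ↦
  have h := mem_spectrum_diff_weylSpectrum_iff.1 hz
  ⟨h.1, h.2.1.finite_ker⟩

theorem eventually_isWeyl_shift {T : X →L[ℂ] X} {z : ℂ} (h : IsWeyl (shift T z)) :
    ∀ᶠ w in 𝓝[≠] z, IsWeyl (shift T w) := by
  have h1 := (eventually_hasIndexZero_sub_smul (isWeyl_iff_hasIndexZero.1 h)).filter_mono
    (nhdsWithin_le_nhds (s := {0}ᶜ))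
  filter_upwards [(tendsto_sub_nhdsNE_zero z).eventually h1] with w hw
  rw [isWeyl_iff_hasIndexZero, ← shift_shift T z w]
  exact hw

/-- A point of `E_a(T)` outside the Weyl spectrum is isolated in the spectrum. -/
theorem mem_E0_of_mem_Ea {T : X →L[ℂ] X} {z : ℂ} (hz : z ∈ Ea T) (h : IsWeyl (shift T z)) :
    z ∈ E0 T := by
  refine ⟨mem_iso_iff.2 ⟨pointSpectrum_subset_spectrum T hz.2, ?_⟩, hz.2, h.1.finite_ker⟩
  filter_upwards [(mem_iso_iff.1 hz.1).2, eventually_isWeyl_shift h] with w hw hW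
  rw [mem_spectrum_iff, not_not]
  exact hW.bijective_of_ker_eq_bot (ker_shift_eq_bot_of_notMem_approxSpectrum hw)

theorem isWeyl_shift_of_mem_finitePoles {T : X →L[ℂ] X} {z : ℂ} (hz : z ∈ finitePoles T) :
    IsWeyl (shift T z) := by
  obtain ⟨⟨-, ha, hd⟩, hk⟩ := hz
  obtain ⟨a, ha⟩ := ascent_lt_top_iff.1 ha
  obtain ⟨d, hd⟩ := descent_lt_top_iff.1 hd
  simp only [toLinearMap_pow] at ha hd
  exact isWeyl_iff_hasIndexZero.2 (hasIndexZero_of_ker_pow_eq_of_range_pow_eq hk ha hd)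

theorem finitePoles_subset (T : X →L[ℂ] X) :
    finitePoles T ⊆ spectrum ℂ T \ weylSpectrum T := fun _ hz ↦
  ⟨hz.1.1, not_not.2 (isWeyl_shift_of_mem_finitePoles hz)⟩

/-- An isolated point of the spectrum outside the Weyl spectrum is a pole of finite rank. -/
theorem mem_finitePoles_of_mem_iso {T : X →L[ℂ] X} {z : ℂ} (hz : z ∈ iso (spectrum ℂ T))
    (h : IsWeyl (shift T z)) : z ∈ finitePoles T := by
  have h' := isWeyl_iff_hasIndexZero.1 h
  have h1 := (tendsto_sub_nhdsNE_zero z).eventually (eventually_ker_sub_smul_eq_bot_iff h'.1)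
  obtain ⟨w, hw, hσ⟩ := (h1.and (mem_iso_iff.1 hz).2).exists
  rw [mem_spectrum_iff, not_not] at hσ
  have hk : (shift (shift T z) (w - z)).ker = ⊥ := by
    rw [shift_shift]
    exact LinearMap.ker_eq_bot.2 hσ.1
  obtain ⟨m, hm1, hm2⟩ := h'.exists_ker_pow_eq_and_range_pow_eq (hw.1 hk)
  simp only [← toLinearMap_pow] at hm1 hm2
  exact ⟨⟨(mem_iso_iff.1 hz).1, ascent_lt_top_iff.2 ⟨m, hm1⟩, descent_lt_top_iff.2 ⟨m, hm2⟩⟩,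
    h.1.finite_ker⟩

theorem IsWeyl.isBWeyl {S : X →L[ℂ] X} (h : IsWeyl S) : IsBWeyl S := by
  have hr : IsClosed ((S ^ 0).range : Set X) := by
    rw [pow_zero, LinearMap.range_eq_top.2 Function.surjective_id]
    exact isClosed_univ
  have : CompleteSpace (S ^ 0).range := hr.completeSpace_coe
  have hk : FiniteDimensional ℂ (S ^ 0).ker := by
    rw [pow_zero, LinearMap.ker_eq_bot.2 Function.injective_id]
    infer_instance
  exact ⟨0, hr, isWeyl_iff_hasIndexZero.2
    ((restrictRangePow_hasIndexZero_iff 0 hk).1 (isWeyl_iff_hasIndexZero.1 h))⟩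

theorem IsBWeyl.isWeyl_of_finiteDimensional_ker {S : X →L[ℂ] X} (h : IsBWeyl S)
    (hk : FiniteDimensional ℂ S.ker) : IsWeyl S := by
  obtain ⟨n, hr, hn⟩ := h
  have : CompleteSpace (S ^ n).range := hr.completeSpace_coe
  have hkn : FiniteDimensional ℂ (S ^ n).ker := by
    rw [toLinearMap_pow]
    exact finiteDimensional_ker_pow hk n
  exact isWeyl_iff_hasIndexZero.2
    ((restrictRangePow_hasIndexZero_iff n hkn).2 (isWeyl_iff_hasIndexZero.1 hn))

/-- The punctured neighbourhood theorem for B-Weyl operators. -/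
theorem IsBWeyl.eventually_shift {T : X →L[ℂ] X} {z : ℂ} (h : IsBWeyl (shift T z)) :
    ∃ p : Prop, ∀ᶠ w in 𝓝[≠] z, IsWeyl (shift T w) ∧ ((shift T w).ker = ⊥ ↔ p) := by
  obtain ⟨n, hr, hn⟩ := h
  have : CompleteSpace (shift T z ^ n).range := hr.completeSpace_coe
  have hn' := isWeyl_iff_hasIndexZero.1 hn
  have h1 := (tendsto_sub_nhdsNE_zero z).eventually (eventually_ker_sub_smul_eq_bot_iff hn'.1)
  have h2 := (tendsto_sub_nhdsNE_zero z).eventually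
    ((eventually_hasIndexZero_sub_smul hn').filter_mono (nhdsWithin_le_nhds (s := {0}ᶜ)))
  -- The proposition is injectivity of `S_[n]` on its hyperrange, where `S = T - z`; it does not
  -- depend on `w`.
  refine ⟨(restrictRangePow (shift T z) n).ker ⊓
    (restrictRangePow (shift T z) n).toLinearMap.hyperrange = ⊥, ?_⟩
  filter_upwards [h1, h2, self_mem_nhdsWithin] with w hw1 hw2 hw
  have hc : w - z ≠ 0 := sub_ne_zero.2 hw
  rw [← hw1, isWeyl_iff_hasIndexZero, ← shift_shift T z w]
  have hp := congr(LinearMap.range $(toLinearMap_pow (shift T z) n))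
  exact ⟨hw2.of_range_pow hp hc fun _ ↦ rfl, ker_eq_bot_iff_of_range_pow hp hc fun _ ↦ rfl⟩

/-- Near `z` either all `T - w` are bijective, or all are Weyl and non-injective. The latter would
fill a punctured neighbourhood with isolated points of the spectrum, which is absurd. -/
theorem spectrum_diff_bWeylSpectrum_subset_E {T : X →L[ℂ] X}
    (h : spectrum ℂ T \ weylSpectrum T ⊆ iso (spectrum ℂ T)) :
    spectrum ℂ T \ bWeylSpectrum T ⊆ E T := by
  rintro z ⟨hz, hB⟩
  have hB : IsBWeyl (shift T z) := not_not.1 hB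
  obtain ⟨p, hp⟩ := hB.eventually_shift
  have hpt : p := by
    by_contra hnp
    have hσ : ∀ᶠ w in 𝓝[≠] z, w ∈ spectrum ℂ T ∧ w ∈ iso (spectrum ℂ T) := by
      filter_upwards [hp] with w ⟨hw, hk⟩
      have := mem_spectrum_diff_weylSpectrum_iff.2 ⟨fun h0 ↦ hnp (hk.1 h0), hw⟩
      exact ⟨this.1, h this⟩
    obtain ⟨w, ⟨hw, hi⟩, hwz⟩ := (((eventually_eventually_nhdsWithin.2 hσ).and hσ).and
      self_mem_nhdsWithin).exists
    -- As `w ≠ z`, a full neighbourhood of `w` lies in the spectrum, although `w` is isolated there.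
    rw [isOpen_compl_singleton.nhdsWithin_eq hwz] at hw
    obtain ⟨v, hv, hv'⟩ := ((hw.filter_mono (nhdsWithin_le_nhds (s := {w}ᶜ))).and
      (mem_iso_iff.1 hi.2).2).exists
    exact hv' hv.1
  refine ⟨mem_iso_iff.2 ⟨hz, ?_⟩, fun hk ↦ ?_⟩
  · filter_upwards [hp] with w ⟨hw, hk⟩
    rw [mem_spectrum_iff, not_not]
    exact hw.bijective_of_ker_eq_bot (hk.2 hpt)
  -- A trivial kernel would make the B-Weyl operator Weyl, hence bijective.
  · have hkf : FiniteDimensional ℂ (shift T z).ker := by rw [hk]; infer_instance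
    exact mem_spectrum_iff.1 hz
      ((hB.isWeyl_of_finiteDimensional_ker hkf).bijective_of_ker_eq_bot hk)

theorem PropertyZEa.weylTheorem_and_E0_eq_Ea {T : X →L[ℂ] X} (h : PropertyZEa T) :
    WeylTheorem T ∧ E0 T = Ea T := by
  have hE : E0 T = Ea T := by
    refine ((E0_subset_E T).trans (E_subset_Ea T)).antisymm fun z hz ↦ mem_E0_of_mem_Ea hz ?_
    have hz' : z ∈ spectrum ℂ T \ weylSpectrum T := by rw [h]; exact hz
    exact (mem_spectrum_diff_weylSpectrum_iff.1 hz').2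
  exact ⟨Eq.trans h hE.symm, hE⟩

end WeylType

/-! ### The equivalences. -/

theorem mainTheorem10 {X : Type*} [NormedAddCommGroup X] [NormedSpace ℂ X] [CompleteSpace X]
    (hX : ¬ FiniteDimensional ℂ X) (T : X →L[ℂ] X) :
    List.TFAE
      [WeylType.PropertyZEa T,
       WeylType.WeylTheorem T ∧ WeylType.E0 T = WeylType.Ea T,
       WeylType.BrowderTheorem T ∧ WeylType.finitePoles T = WeylType.Ea T,
       WeylType.GeneralizedWeylTheorem T ∧ WeylType.E0 T = WeylType.Ea T] := by
  have h12 := WeylType.PropertyZEa.weylTheorem_and_E0_eq_Ea (T := T)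
  tfae_have 1 → 2 := h12
  tfae_have 2 → 1 := fun h ↦ h.1.trans h.2
  tfae_have 1 → 3 := fun h ↦ by
    obtain ⟨hW, hE⟩ := h12 h
    have hP : WeylType.finitePoles T = spectrum ℂ T \ WeylType.weylSpectrum T := by
      refine (WeylType.finitePoles_subset T).antisymm fun z hz ↦ ?_
      have hz' : z ∈ WeylType.E0 T := by rw [← hW]; exact hz
      exact WeylType.mem_finitePoles_of_mem_iso hz'.1
        (WeylType.mem_spectrum_diff_weylSpectrum_iff.1 hz).2
    exact ⟨hP.symm, hP.trans h⟩
  tfae_have 3 → 1 := fun h ↦ h.1.trans h.2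
  tfae_have 1 → 4 := fun h ↦ by
    obtain ⟨hW, hE⟩ := h12 h
    refine ⟨Set.Subset.antisymm ?_ fun z hz ↦ ?_, hE⟩
    · refine WeylType.spectrum_diff_bWeylSpectrum_subset_E fun z hz ↦ ?_
      have hz' : z ∈ WeylType.E0 T := by rw [← hW]; exact hz
      exact hz'.1
    · have hz' : z ∈ spectrum ℂ T \ WeylType.weylSpectrum T := by
        rw [h]; exact WeylType.E_subset_Ea T hz
      exact ⟨hz'.1, not_not.2 (WeylType.mem_spectrum_diff_weylSpectrum_iff.1 hz').2.isBWeyl⟩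
  tfae_have 4 → 2 := fun h ↦ by
    refine ⟨Set.Subset.antisymm (fun z hz ↦ ?_) fun z hz ↦ ?_, h.2⟩
    · have hz' : z ∈ WeylType.E T := by
        rw [← h.1]
        exact ⟨hz.1, not_not.2 (WeylType.mem_spectrum_diff_weylSpectrum_iff.1 hz).2.isBWeyl⟩
      exact ⟨hz'.1, WeylType.spectrum_diff_weylSpectrum_subset_finitePointSpectrum T hz⟩
    · have hz' : z ∈ spectrum ℂ T \ WeylType.bWeylSpectrum T := by
        rw [h.1]; exact WeylType.E0_subset_E T hz
      exact ⟨hz'.1, not_not.2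
        ((not_not.1 hz'.2 : WeylType.IsBWeyl _).isWeyl_of_finiteDimensional_ker hz.2.2)⟩
  tfae_finish
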